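/- Strong maximum principle. Let $n\ge 1$. For a real symmetric $n\times n$ matrix $X$ let $\lambda_1(X)\le\dots\le\lambda_n(X)$ be its eigenvalues counted with multiplicity. For ${\bf a}=(a_1,\dots,a_n)\in\mathbb R^n$ with $a_i\ge 0$ for all $i$ put $\mathcal M_{\bf a}(X)=\sum_{i=1}^n a_i\lambda_i(X)$. Let $\Omega\subset\mathbb R^n$ be a domain, i.e. a nonempty connected open set. A continuous function $u:\Omega\to\mathbb R$ is called a viscosity supersolution (resp. subsolution) of $\mathcal M_{\bf a}(D^2u)=0$ in $\Omega$ if $\mathcal M_{\bf a}(X)\le 0$ (resp. $\mathcal M_{\bf a}(X)\ge 0$) for every $x_0\in\Omega$, every $\xi\in\mathbb R^n$ and every real symmetric $n\times n$ matrix $X$ for which $$u(x)\ \ge\ u(x_0)+\langle\xi,x-x_0\rangle+\tfrac12\langle X(x-x_0),x-x_0\rangle+o(|x-x_0|^2)\quad\text{as } x\to x_0$$ (resp. the same with $\le$ in place of $\ge$). (i) Suppose $a_n>0$, and let $u$ be a non-negative continuous viscosity supersolution of $\mathcal M_{\bf a}(D^2u)=0$ in $\Omega$. If $u$ attains its minimum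 $m$ over $\Omega$ at some point $x_0\in\Omega$, then $u\equiv m$ in $\Omega$. (ii) Suppose $a_1>0$, and let $u$ be a continuous viscosity subsolution of $\mathcal M_{\bf a}(D^2u)=0$ in $\Omega$. If $u$ attains its maximum $M$ over $\Omega$ at some point $x_0\in\Omega$, then $u\equiv M$ in $\Omega$. -/

import Mathlib

open Filter Topology Asymptotics

noncomputable section

/-- The set `S^n` of real symmetric `n × n` matrices. -/
abbrev SymMat (n : ℕ) : Type := {X : Matrix (Fin n) (Fin n) ℝ // X.IsSymm}

theorem SymMat.isHermitian {n : ℕ} (X : SymMat n) : X.1.IsHermitian := by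
  rw [Matrix.IsHermitian, Matrix.conjTranspose_eq_transpose_of_trivial]
  exact X.2

/-- The eigenvalues `λ_1(X) ≤ ... ≤ λ_n(X)` of a symmetric matrix, counted with multiplicity, in
increasing order; the index `i : Fin n` is the mathematical index minus one. (Mathlib's
`eigenvalues₀` lists them in decreasing order.) -/
def SymMat.eig {n : ℕ} (X : SymMat n) (i : Fin n) : ℝ :=
  X.isHermitian.eigenvalues₀ (Fin.cast (Fintype.card_fin n).symm i.rev)

theorem SymMat.eig_monotone {n : ℕ} (X : SymMat n) : Monotone X.eig := by
  intro i j hij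
  refine X.isHermitian.eigenvalues₀_antitone ?_
  have h : j.rev ≤ i.rev := Fin.rev_le_rev.mpr hij
  exact h

theorem SymMat.roots_charpoly_eq_eig {n : ℕ} (X : SymMat n) :
    X.1.charpoly.roots = Multiset.map X.eig Finset.univ.val := by
  rw [X.isHermitian.roots_charpoly_eq_eigenvalues₀]
  have key : Finset.univ.val = Multiset.map
      (fun i : Fin n => Fin.cast (Fintype.card_fin n).symm i.rev) Finset.univ.val := by
    have := Finset.map_univ_equiv
      (Fin.revPerm.trans (finCongr (Fintype.card_fin n).symm))
    rw [← this]
    rfl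
  rw [key, Multiset.map_map]
  rfl

/-- The weighted partial trace operator `M_a(X) = a_1 λ_1(X) + ... + a_n λ_n(X)`. -/
def weightedPartialTrace {n : ℕ} (a : Fin n → ℝ) (X : SymMat n) : ℝ :=
  ∑ i, a i * X.eig i

/-- The quadratic polynomial `u(x₀) + ⟨ξ, x - x₀⟩ + ½ ⟨X (x - x₀), x - x₀⟩`. -/
def jetPolynomial {n : ℕ} (u : EuclideanSpace ℝ (Fin n) → ℝ) (x₀ ξ : EuclideanSpace ℝ (Fin n))
    (X : SymMat n) (x : EuclideanSpace ℝ (Fin n)) : ℝ :=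
  u x₀ + inner ℝ ξ (x - x₀) + 1 / 2 * inner ℝ (Matrix.toEuclideanLin X.1 (x - x₀)) (x - x₀)

/-- The second order superjet `J^{2,+}_O u(x₀)`: the pairs `(ξ, X)` such that
`u(x) ≤ u(x₀) + ⟨ξ, x - x₀⟩ + ½ ⟨X (x - x₀), x - x₀⟩ + o(|x - x₀|²)` as `x → x₀` in `O`. -/
def superjet {n : ℕ} (O : Set (EuclideanSpace ℝ (Fin n))) (u : EuclideanSpace ℝ (Fin n) → ℝ)
    (x₀ : EuclideanSpace ℝ (Fin n)) : Set (EuclideanSpace ℝ (Fin n) × SymMat n) :=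
  {p | ∃ r : EuclideanSpace ℝ (Fin n) → ℝ,
    r =o[𝓝[O] x₀] (fun x => ‖x - x₀‖ ^ 2) ∧
      ∀ᶠ x in 𝓝[O] x₀, u x ≤ jetPolynomial u x₀ p.1 p.2 x + r x}

/-- The second order subjet `J^{2,-}_O u(x₀)`: the pairs `(ξ, X)` such that
`u(x) ≥ u(x₀) + ⟨ξ, x - x₀⟩ + ½ ⟨X (x - x₀), x - x₀⟩ + o(|x - x₀|²)` as `x → x₀` in `O`. -/
def subjet {n : ℕ} (O : Set (EuclideanSpace ℝ (Fin n))) (u : EuclideanSpace ℝ (Fin n) → ℝ)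
    (x₀ : EuclideanSpace ℝ (Fin n)) : Set (EuclideanSpace ℝ (Fin n) × SymMat n) :=
  {p | ∃ r : EuclideanSpace ℝ (Fin n) → ℝ,
    r =o[𝓝[O] x₀] (fun x => ‖x - x₀‖ ^ 2) ∧
      ∀ᶠ x in 𝓝[O] x₀, jetPolynomial u x₀ p.1 p.2 x + r x ≤ u x}

/-- `u` is a viscosity subsolution of `F(D²u) = f` in `O`. -/
def IsViscositySubsolution {n : ℕ} (F : SymMat n → ℝ) (f : EuclideanSpace ℝ (Fin n) → ℝ)
    (O : Set (EuclideanSpace ℝ (Fin n))) (u : EuclideanSpace ℝ (Fin n) → ℝ) : Prop :=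
  UpperSemicontinuousOn u O ∧ ∀ x ∈ O, ∀ p ∈ superjet O u x, f x ≤ F p.2

/-- `u` is a viscosity supersolution of `F(D²u) = f` in `O`. -/
def IsViscositySupersolution {n : ℕ} (F : SymMat n → ℝ) (f : EuclideanSpace ℝ (Fin n) → ℝ)
    (O : Set (EuclideanSpace ℝ (Fin n))) (u : EuclideanSpace ℝ (Fin n) → ℝ) : Prop :=
  LowerSemicontinuousOn u O ∧ ∀ x ∈ O, ∀ p ∈ subjet O u x, F p.2 ≤ f x

end

open Metric

/-! This is Hopf's argument. If the set of minimum points were not open, some ball would meet it at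
exactly one point `z`, lying on its boundary sphere (`eventually_eq_of_isMinOn`). A small multiple
of `(L - |x - y|²)²`, with `y` the centre, then touches `u` from below, up to a constant, at a point
near `z`. There its Hessian is `c I + d p pᵀ` with `p = x₁ - y`, where `c` is negligible against `d
|p|²`. The large eigenvalue `c + d |p|²` is the top one, so `0 < a_n` makes the operator positive,
which no supersolution allows (`exists_scalarAddRankOne_mem_subjet`). For subsolutions the same
applies to `-u`: the Hessian changes sign, the dominant eigenvalue becomes the lowest, and `a_1`
takes the role of `a_n`. -/

/-! ### Spectrum of `c I + d p pᵀ` -/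

/-- The symmetric matrix `c I + d p pᵀ`. -/
def scalarAddRankOne {n : ℕ} (c d : ℝ) (p : EuclideanSpace ℝ (Fin n)) : SymMat n :=
  ⟨c • (1 : Matrix (Fin n) (Fin n) ℝ) + d • Matrix.vecMulVec p.ofLp p.ofLp, by
    ext i j
    simp only [Matrix.transpose_apply, Matrix.add_apply, Matrix.smul_apply, Matrix.one_apply,
      Matrix.vecMulVec_apply, smul_eq_mul, eq_comm (a := j) (b := i)]
    ring⟩

theorem toEuclideanLin_scalarAddRankOne {n : ℕ} (c d : ℝ) (p v : EuclideanSpace ℝ (Fin n)) :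
    Matrix.toEuclideanLin (scalarAddRankOne c d p).1 v = c • v + (d * inner ℝ p v) • p := by
  ext i
  simp only [scalarAddRankOne, Matrix.toLpLin_apply, Matrix.add_mulVec, Matrix.smul_mulVec,
    Matrix.one_mulVec, Matrix.vecMulVec_mulVec, PiLp.add_apply, PiLp.smul_apply, Pi.add_apply,
    Pi.smul_apply, smul_eq_mul, EuclideanSpace.inner_eq_star_dotProduct, star_trivial,
    MulOpposite.smul_eq_mul_unop, MulOpposite.unop_op, dotProduct_comm v.ofLp]
  ring

theorem SymMat.exists_eig_eq_iff {n : ℕ} (X : SymMat n) (t : ℝ) :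
    (∃ i, X.eig i = t) ↔ ∃ v : EuclideanSpace ℝ (Fin n), v ≠ 0 ∧
      Matrix.toEuclideanLin X.1 v = t • v := by
  have h : (∃ i, X.eig i = t) ↔ t ∈ X.1.charpoly.roots := by
    rw [X.roots_charpoly_eq_eig]; simp
  rw [h, Polynomial.mem_roots X.1.charpoly_monic.ne_zero, ← Matrix.charpoly_toLin',
    ← Module.End.hasEigenvalue_iff_isRoot_charpoly]
  constructor
  · intro h
    obtain ⟨v, hv⟩ := h.exists_hasEigenvector
    refine ⟨WithLp.toLp 2 v, by simpa using hv.2, ?_⟩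
    have := hv.apply_eq_smul
    rw [Matrix.toLin'_apply] at this
    rw [Matrix.toLpLin_toLp, Matrix.toLin'_apply, this]
    rfl
  · rintro ⟨v, hv, h⟩
    refine Module.End.hasEigenvalue_of_hasEigenvector (x := v.ofLp)
      ⟨Module.End.mem_eigenspace_iff.2 ?_, by simpa using hv⟩
    have := congrArg WithLp.ofLp h
    simpa [Matrix.toLpLin_apply] using this

/-- Pair the eigenvector equation with `p`. Multiplicities are never needed: this dichotomy and the
attained value `c + d |p|²` determine the extreme eigenvalue. -/
theorem eig_scalarAddRankOne {n : ℕ} (c d : ℝ) (p : EuclideanSpace ℝ (Fin n)) (i : Fin n) :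
    (scalarAddRankOne c d p).eig i = c ∨
      (scalarAddRankOne c d p).eig i = c + d * ‖p‖ ^ 2 := by
  obtain ⟨v, hv, h⟩ := ((scalarAddRankOne c d p).exists_eig_eq_iff _).1 ⟨i, rfl⟩
  generalize (scalarAddRankOne c d p).eig i = t at h
  rw [toEuclideanLin_scalarAddRankOne] at h
  by_cases hp : inner ℝ p v = 0
  · left
    rw [hp, mul_zero, zero_smul, add_zero] at h
    exact (smul_left_injective ℝ hv h).symm
  · right
    have := congrArg (inner ℝ p) h
    rw [inner_add_right, inner_smul_right, inner_smul_right, inner_smul_right,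
      real_inner_self_eq_norm_sq] at this
    refine (mul_right_cancel₀ hp ?_).symm
    linarith

theorem exists_eig_scalarAddRankOne {n : ℕ} (c d : ℝ) {p : EuclideanSpace ℝ (Fin n)}
    (hp : p ≠ 0) : ∃ i, (scalarAddRankOne c d p).eig i = c + d * ‖p‖ ^ 2 := by
  rw [SymMat.exists_eig_eq_iff]
  refine ⟨p, hp, ?_⟩
  rw [toEuclideanLin_scalarAddRankOne, real_inner_self_eq_norm_sq, add_smul]

theorem le_weightedPartialTrace_scalarAddRankOne {n : ℕ} (hn : 1 ≤ n) {a : Fin n → ℝ}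
    (ha : ∀ i, 0 ≤ a i) (c : ℝ) {d : ℝ} (hd : 0 ≤ d) {p : EuclideanSpace ℝ (Fin n)}
    (hp : p ≠ 0) :
    c * ∑ i, a i + d * ‖p‖ ^ 2 * a ⟨n - 1, Nat.sub_one_lt_of_lt hn⟩ ≤
      weightedPartialTrace a (scalarAddRankOne c d p) := by
  set X := scalarAddRankOne c d p with hX
  have hdp : 0 ≤ d * ‖p‖ ^ 2 := by positivity
  have hle (i) : 0 ≤ a i * (X.eig i - c) := by
    refine mul_nonneg (ha i) ?_
    rcases eig_scalarAddRankOne c d p i with h | h <;> rw [← hX] at h <;> linarith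
  obtain ⟨j, hj⟩ := exists_eig_scalarAddRankOne c d hp
  have hlast : X.eig j ≤ X.eig ⟨n - 1, Nat.sub_one_lt_of_lt hn⟩ :=
    X.eig_monotone (Fin.le_def.2 (Nat.le_sub_one_of_lt j.2))
  have h1 := Finset.single_le_sum (fun i _ => hle i)
    (Finset.mem_univ (⟨n - 1, Nat.sub_one_lt_of_lt hn⟩ : Fin n))
  have h2 : a ⟨n - 1, Nat.sub_one_lt_of_lt hn⟩ * (d * ‖p‖ ^ 2) ≤
      a ⟨n - 1, Nat.sub_one_lt_of_lt hn⟩ * (X.eig ⟨n - 1, Nat.sub_one_lt_of_lt hn⟩ - c) :=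
    mul_le_mul_of_nonneg_left (by rw [← hX] at hj; linarith) (ha _)
  simp only [mul_sub, Finset.sum_sub_distrib, ← Finset.sum_mul] at h1
  rw [weightedPartialTrace]
  linarith

theorem weightedPartialTrace_scalarAddRankOne_le {n : ℕ} (hn : 1 ≤ n) {a : Fin n → ℝ}
    (ha : ∀ i, 0 ≤ a i) (c : ℝ) {d : ℝ} (hd : d ≤ 0) {p : EuclideanSpace ℝ (Fin n)}
    (hp : p ≠ 0) :
    weightedPartialTrace a (scalarAddRankOne c d p) ≤
      c * ∑ i, a i + d * ‖p‖ ^ 2 * a ⟨0, hn⟩ := by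
  set X := scalarAddRankOne c d p with hX
  have hdp : d * ‖p‖ ^ 2 ≤ 0 := mul_nonpos_of_nonpos_of_nonneg hd (by positivity)
  have hle (i) : 0 ≤ a i * (c - X.eig i) := by
    refine mul_nonneg (ha i) ?_
    rcases eig_scalarAddRankOne c d p i with h | h <;> rw [← hX] at h <;> linarith
  obtain ⟨j, hj⟩ := exists_eig_scalarAddRankOne c d hp
  have hfirst : X.eig ⟨0, hn⟩ ≤ X.eig j := X.eig_monotone (Fin.le_def.2 (Nat.zero_le _))
  have h1 := Finset.single_le_sum (fun i _ => hle i) (Finset.mem_univ (⟨0, hn⟩ : Fin n))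
  have h2 : a ⟨0, hn⟩ * (-(d * ‖p‖ ^ 2)) ≤ a ⟨0, hn⟩ * (c - X.eig ⟨0, hn⟩) :=
    mul_le_mul_of_nonneg_left (by rw [← hX] at hj; linarith) (ha _)
  simp only [mul_sub, Finset.sum_sub_distrib, ← Finset.sum_mul] at h1
  rw [weightedPartialTrace]
  linarith

/-! ### The quartic barrier -/

/-- A function touched from below at `x₁` by a multiple of `(L - |x - y|²)²` has the second order
jet of this barrier in its subjet. -/
theorem mem_subjet_of_barrier {n : ℕ} {Ω : Set (EuclideanSpace ℝ (Fin n))}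
    {u : EuclideanSpace ℝ (Fin n) → ℝ} {x₁ y : EuclideanSpace ℝ (Fin n)} {L ε : ℝ}
    (h : ∀ᶠ x in 𝓝[Ω] x₁,
      u x₁ + ε * ((L - ‖x - y‖ ^ 2) ^ 2 - (L - ‖x₁ - y‖ ^ 2) ^ 2) ≤ u x) :
    ((-4 * ε * (L - ‖x₁ - y‖ ^ 2)) • (x₁ - y),
      scalarAddRankOne (-4 * ε * (L - ‖x₁ - y‖ ^ 2)) (8 * ε) (x₁ - y)) ∈ subjet Ω u x₁ := by
  -- The exact cubic and quartic terms of the barrier's Taylor expansion at `x₁`.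
  refine ⟨fun x => (ε * (‖x - x₁‖ ^ 2 + 4 * inner ℝ (x₁ - y) (x - x₁))) * ‖x - x₁‖ ^ 2, ?_, ?_⟩
  · have ht : Tendsto (fun x => ε * (‖x - x₁‖ ^ 2 + 4 * inner ℝ (x₁ - y) (x - x₁)))
        (𝓝[Ω] x₁) (𝓝 0) := by
      have hc : Continuous
          (fun x => ε * (‖x - x₁‖ ^ 2 + 4 * inner ℝ (x₁ - y) (x - x₁))) := by fun_prop
      simpa using (hc.tendsto x₁).mono_left nhdsWithin_le_nhds
    simpa using ((isLittleO_one_iff ℝ).2 ht).mul_isBigO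
      (isBigO_refl (fun x => ‖x - x₁‖ ^ 2) (𝓝[Ω] x₁))
  · filter_upwards [h] with x hx
    refine le_trans (le_of_eq ?_) hx
    have hxy : x - y = (x₁ - y) + (x - x₁) := by abel
    rw [hxy, norm_add_sq_real, jetPolynomial, toEuclideanLin_scalarAddRankOne, inner_add_left,
      real_inner_smul_left, real_inner_smul_left, real_inner_smul_left,
      real_inner_self_eq_norm_sq]
    ring

/-- At a point `z` where `u` has a minimum that is strict in a closed ball with `z` on its boundary,
the quartic barrier touches `u` from below near `z`. -/
theorem exists_scalarAddRankOne_mem_subjet {n : ℕ} {Ω : Set (EuclideanSpace ℝ (Fin n))}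
    (hΩ : IsOpen Ω) {u : EuclideanSpace ℝ (Fin n) → ℝ} (hu : ContinuousOn u Ω)
    {y z : EuclideanSpace ℝ (Fin n)} (hz : z ∈ Ω) (hmin : IsMinOn u Ω z) (hyz : z ≠ y)
    (hball : ∀ x ∈ Ω, ‖x - y‖ ≤ ‖z - y‖ → x ≠ z → u z < u x) {S t : ℝ} (hS : 0 ≤ S)
    (ht : 0 < t) :
    ∃ x₁ ∈ Ω, ∃ ξ p : EuclideanSpace ℝ (Fin n), ∃ c d : ℝ, p ≠ 0 ∧ 0 ≤ d ∧
      0 < c * S + d * ‖p‖ ^ 2 * t ∧ (ξ, scalarAddRankOne c d p) ∈ subjet Ω u x₁ := by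
  set R := ‖z - y‖ with hR
  have hR0 : 0 < R := norm_pos_iff.2 (sub_ne_zero.2 hyz)
  obtain ⟨r₀, hr₀, hr₀Ω⟩ := Metric.isOpen_iff.1 hΩ z hz
  -- The last bound gives `4RρS < 2(R/2)²t`; on the ball `L - |x - y|² ≤ 4Rρ` and `|x - y| ≥ R/2`,
  -- so the rank-one term wins.
  obtain ⟨ρ, hρ0, hρ1, hρ2, hρ3⟩ : ∃ ρ > 0, ρ < r₀ ∧ ρ < R / 2 ∧ 8 * S * ρ < R * t := by
    have h3 : ∀ᶠ ρ in 𝓝[>] (0 : ℝ), 8 * S * ρ < R * t := by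
      have hc : Continuous (fun ρ : ℝ => 8 * S * ρ) := by fun_prop
      refine ((hc.tendsto 0).mono_left nhdsWithin_le_nhds).eventually_lt_const ?_
      simpa using mul_pos hR0 ht
    obtain ⟨ρ, h3, h1, h2⟩ := (h3.and
      (eventually_mem_set.2 (Ioo_mem_nhdsGT (lt_min hr₀ (half_pos hR0))))).exists
    exact ⟨ρ, h1, h2.trans_le (min_le_left _ _), h2.trans_le (min_le_right _ _), h3⟩
  have hB : closedBall z ρ ⊆ Ω := (closedBall_subset_ball hρ1).trans hr₀Ω
  have hBnorm {x} (hx : x ∈ closedBall z ρ) : R - ρ ≤ ‖x - y‖ ∧ ‖x - y‖ ≤ R + ρ := by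
    rw [mem_closedBall, dist_eq_norm] at hx
    have h1 := norm_add_le (x - z) (z - y)
    have h2 := norm_sub_le (x - y) (x - z)
    rw [sub_add_sub_cancel] at h1
    rw [sub_sub_sub_cancel_left, norm_sub_rev] at h2
    constructor <;> linarith [norm_sub_rev z y]
  -- With this `L` the barrier decreases in `|x - y|` throughout the closed ball around `z`.
  set L := (R + ρ) ^ 2 with hL
  obtain ⟨η, hη, hηle⟩ : ∃ η > 0, ∀ x ∈ sphere z ρ ∩ closedBall y R, u z + η ≤ u x := by
    have hC : IsCompact (sphere z ρ ∩ closedBall y R) :=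
      (isCompact_sphere z ρ).inter_right isClosed_closedBall
    rcases (sphere z ρ ∩ closedBall y R).eq_empty_or_nonempty with he | hne
    · exact ⟨1, one_pos, by simp [he]⟩
    have hCΩ : sphere z ρ ∩ closedBall y R ⊆ Ω := fun x hx => hB (sphere_subset_closedBall hx.1)
    obtain ⟨x', hx', hx'min⟩ := hC.exists_isMinOn hne (hu.mono hCΩ)
    have hlt : u z < u x' := by
      refine hball x' (hCΩ hx') (by simpa [dist_eq_norm] using hx'.2) ?_
      rintro rfl
      have := hx'.1
      rw [mem_sphere, dist_self] at this
      exact hρ0.ne this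
    refine ⟨u x' - u z, sub_pos.2 hlt, fun x hx => ?_⟩
    have : u x' ≤ u x := hx'min hx
    linarith
  have hL0 : 0 < L := by positivity
  set ε := η / L ^ 2 with hε
  have hε0 : 0 < ε := by positivity
  set g : EuclideanSpace ℝ (Fin n) → ℝ := fun x => u x - ε * (L - ‖x - y‖ ^ 2) ^ 2 with hg
  have hsphere : ∀ x ∈ sphere z ρ, g z ≤ g x := by
    -- Inside the ball around `y`, the gap `η = ε L²` absorbs the barrier; outside it, the barrier
    -- is no larger than at `z`.
    intro x hx
    have hxb := sphere_subset_closedBall hx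
    obtain ⟨hx1, hx2⟩ := hBnorm hxb
    have hzx : u z ≤ u x := hmin (hB hxb)
    have hw0 : 0 ≤ L - ‖x - y‖ ^ 2 := by
      have := pow_le_pow_left₀ (norm_nonneg _) hx2 2
      linarith
    simp only [hg, ← hR]
    rcases le_total ‖x - y‖ R with hxR | hxR
    · have h1 := hηle x ⟨hx, by simpa [dist_eq_norm] using hxR⟩
      have h2 : (L - ‖x - y‖ ^ 2) ^ 2 ≤ L ^ 2 :=
        pow_le_pow_left₀ hw0 (by linarith [sq_nonneg ‖x - y‖]) 2
      have h3 : ε * (L - ‖x - y‖ ^ 2) ^ 2 ≤ η := by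
        calc _ ≤ ε * L ^ 2 := mul_le_mul_of_nonneg_left h2 hε0.le
          _ = η := by rw [hε]; field_simp
      have h4 : 0 ≤ ε * (L - R ^ 2) ^ 2 := by positivity
      linarith
    · have h1 := pow_le_pow_left₀ hR0.le hxR 2
      have h2 : (L - ‖x - y‖ ^ 2) ^ 2 ≤ (L - R ^ 2) ^ 2 :=
        pow_le_pow_left₀ hw0 (by linarith) 2
      have h3 := mul_le_mul_of_nonneg_left h2 hε0.le
      linarith
  have hgc : ContinuousOn g (closedBall z ρ) :=
    (hu.mono hB).sub (Continuous.continuousOn (by fun_prop))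
  obtain ⟨x₁, hx₁, hx₁min⟩ : ∃ x₁ ∈ ball z ρ, IsMinOn g (closedBall z ρ) x₁ := by
    obtain ⟨x₁, hx₁, hx₁min⟩ := (isCompact_closedBall z ρ).exists_isMinOn
      ⟨z, mem_closedBall_self hρ0.le⟩ hgc
    rcases (mem_closedBall.1 hx₁).lt_or_eq with h | h
    · exact ⟨x₁, h, hx₁min⟩
    -- A minimizer on the sphere can be replaced by the centre `z`.
    · exact ⟨z, mem_ball_self hρ0, fun x hx => (hsphere x₁ h).trans (hx₁min hx)⟩
  obtain ⟨hx1, hx2⟩ := hBnorm (ball_subset_closedBall hx₁)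
  have hpos : R / 2 < ‖x₁ - y‖ := by linarith
  refine ⟨x₁, hB (ball_subset_closedBall hx₁), _, x₁ - y, -4 * ε * (L - ‖x₁ - y‖ ^ 2), 8 * ε,
    norm_pos_iff.1 (by linarith), by positivity, ?_, mem_subjet_of_barrier (L := L) ?_⟩
  · have h1 : (R / 2) ^ 2 * t ≤ ‖x₁ - y‖ ^ 2 * t :=
      mul_le_mul_of_nonneg_right (pow_le_pow_left₀ (by positivity) hpos.le 2) ht.le
    have h2 : (R - ρ) ^ 2 ≤ ‖x₁ - y‖ ^ 2 := pow_le_pow_left₀ (by linarith) hx1 2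
    have h3 : (L - ‖x₁ - y‖ ^ 2) * S ≤ (4 * R * ρ) * S :=
      mul_le_mul_of_nonneg_right (by rw [hL]; linarith) hS
    have h4 : R * (8 * S * ρ) < R * (R * t) := mul_lt_mul_of_pos_left hρ3 hR0
    have h5 : 0 < 4 * ε * (2 * (‖x₁ - y‖ ^ 2 * t) - (L - ‖x₁ - y‖ ^ 2) * S) :=
      mul_pos (by positivity) (by linarith)
    linarith
  · filter_upwards [mem_nhdsWithin_of_mem_nhds (isOpen_ball.mem_nhds hx₁)] with x hx
    have : g x₁ ≤ g x := hx₁min (ball_subset_closedBall hx)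
    simp only [hg] at this
    linarith

/-! ### Propagation of the minimum -/

/-- If no point of an open set is the unique minimum of `u` in a closed ball with that point on the
boundary, then the set of minimum points of `u` is open. -/
theorem eventually_eq_of_isMinOn {n : ℕ} {Ω : Set (EuclideanSpace ℝ (Fin n))}
    (hΩ : IsOpen Ω) {u : EuclideanSpace ℝ (Fin n) → ℝ} (hu : ContinuousOn u Ω)
    (hno : ∀ z ∈ Ω, IsMinOn u Ω z → ∀ y, z ≠ y →
      ∃ x ∈ Ω, ‖x - y‖ ≤ ‖z - y‖ ∧ x ≠ z ∧ u x ≤ u z)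
    {x₀ : EuclideanSpace ℝ (Fin n)} (hx₀ : x₀ ∈ Ω) (hmin : IsMinOn u Ω x₀) :
    ∀ᶠ x in 𝓝 x₀, u x = u x₀ := by
  obtain ⟨r, hr, hrΩ⟩ := Metric.isOpen_iff.1 hΩ x₀ hx₀
  rw [Metric.eventually_nhds_iff_ball]
  refine ⟨r / 4, by positivity, fun y₀ hy₀ => ?_⟩
  by_contra hne
  have hBΩ : closedBall x₀ (r / 2) ⊆ Ω := (closedBall_subset_ball (half_lt_self hr)).trans hrΩ
  set K := closedBall x₀ (r / 2) ∩ u ⁻¹' {u x₀} with hK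
  have hKc : IsCompact K := (isCompact_closedBall x₀ (r / 2)).of_isClosed_subset
    ((hu.mono hBΩ).preimage_isClosed_of_isClosed isClosed_closedBall isClosed_singleton)
    Set.inter_subset_left
  have hx₀K : x₀ ∈ K := ⟨mem_closedBall_self (by positivity), rfl⟩
  obtain ⟨z, hzK, hz⟩ := hKc.exists_infDist_eq_dist ⟨x₀, hx₀K⟩ y₀
  have hdist (x) (hx : x ∈ K) : dist y₀ z ≤ dist y₀ x := hz ▸ infDist_le_dist_of_mem hx
  have huz : u z = u x₀ := hzK.2
  have hzy₀ : z ≠ y₀ := by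
    rintro rfl
    exact hne huz
  -- Several points of `K` may be nearest to `y₀`. The ball of half the radius, centred at the
  -- midpoint of `y₀` and `z`, touches the sphere around `y₀` only at `z`.
  obtain ⟨x, hxΩ, hx1, hx2, hx3⟩ := hno z (hBΩ hzK.1) (fun x hx => huz ▸ hmin hx)
    (midpoint ℝ y₀ z) (by simpa [eq_comm] using hzy₀)
  have hux : u x = u x₀ := le_antisymm (huz ▸ hx3) (hmin hxΩ)
  have hlt : dist y₀ x < dist y₀ z := by
    set q := z - midpoint ℝ y₀ z with hq
    set h := x - midpoint ℝ y₀ z with hh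
    have hmid : midpoint ℝ y₀ z - y₀ = q := by
      rw [hq, midpoint_sub_left, right_sub_midpoint]
    have e1 : x - y₀ = h + q := by rw [← hmid, hh]; abel
    have e2 : z - y₀ = q + q := by nth_rw 1 [← hmid, hq]; abel
    have e3 : h - q = x - z := by rw [hh, hq]; abel
    have hpar := parallelogram_law_with_norm ℝ h q
    have hpos : 0 < ‖h - q‖ := by rw [e3]; exact norm_pos_iff.2 (sub_ne_zero.2 hx2)
    rw [dist_comm, dist_eq_norm, e1, dist_comm, dist_eq_norm, e2, ← two_smul ℝ q, norm_smul,
      Real.norm_two]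
    refine lt_of_pow_lt_pow_left₀ 2 (by positivity) ?_
    have := mul_self_le_mul_self (norm_nonneg h) hx1
    have := mul_pos hpos hpos
    linarith
  -- Membership in `K` holds because `x` is closer to `y₀` than `x₀` is, and `y₀` is within `r / 4`
  -- of `x₀`.
  refine (hdist x ⟨?_, hux⟩).not_gt hlt
  have h1 := hdist x₀ hx₀K
  rw [mem_ball] at hy₀
  rw [mem_closedBall]
  linarith [dist_triangle x y₀ x₀, dist_comm x y₀]

/-- Here `S` stands for `∑ a_i` and `t` for the extreme weight, `a_n` for `u` or `a_1` for `-u`, so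
both halves of the theorem follow. The set of minimum points is open and relatively closed in the
connected set `Ω`. -/
theorem eqOn_of_isMinOn_of_subjet {n : ℕ} {Ω : Set (EuclideanSpace ℝ (Fin n))}
    (hΩ : IsOpen Ω) (hΩc : IsConnected Ω) {u : EuclideanSpace ℝ (Fin n) → ℝ}
    (hu : ContinuousOn u Ω) {S t : ℝ} (hS : 0 ≤ S) (ht : 0 < t)
    (hjet : ∀ x ∈ Ω, ∀ ξ p : EuclideanSpace ℝ (Fin n), ∀ c d : ℝ, p ≠ 0 → 0 ≤ d →
      (ξ, scalarAddRankOne c d p) ∈ subjet Ω u x → c * S + d * ‖p‖ ^ 2 * t ≤ 0)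
    {x₀ : EuclideanSpace ℝ (Fin n)} (hx₀ : x₀ ∈ Ω) (hmin : IsMinOn u Ω x₀) :
    ∀ x ∈ Ω, u x = u x₀ := by
  have hno : ∀ z ∈ Ω, IsMinOn u Ω z → ∀ y, z ≠ y →
      ∃ x ∈ Ω, ‖x - y‖ ≤ ‖z - y‖ ∧ x ≠ z ∧ u x ≤ u z := by
    intro z hz hzmin y hzy
    by_contra! hball
    obtain ⟨x₁, hx₁, ξ, p, c, d, hp, hd, hpos, hmem⟩ :=
      exists_scalarAddRankOne_mem_subjet hΩ hu hz hzmin hzy hball hS ht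
    exact (hjet x₁ hx₁ ξ p c d hp hd hmem).not_gt hpos
  have hopen : IsOpen (Ω ∩ u ⁻¹' {u x₀}) := by
    rw [isOpen_iff_mem_nhds]
    rintro x ⟨hx, hux : u x = u x₀⟩
    filter_upwards [hΩ.mem_nhds hx,
      eventually_eq_of_isMinOn hΩ hu hno hx (fun y hy => hux ▸ hmin hy)] with y hy huy
    exact ⟨hy, huy.trans hux⟩
  have hsub := hΩc.isPreconnected.subset_of_closure_inter_subset hopen ⟨x₀, hx₀, hx₀, rfl⟩ ?_
  · exact fun x hx => (hsub hx).2
  · rintro x ⟨hxc, hx⟩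
    refine ⟨hx, ?_⟩
    have h2 := ((hu x hx).mono Set.inter_subset_left).mem_closure_image hxc
    exact closure_minimal (Set.image_subset_iff.2 Set.inter_subset_right) isClosed_singleton h2

theorem neg_scalarAddRankOne_mem_superjet {n : ℕ} {Ω : Set (EuclideanSpace ℝ (Fin n))}
    {u : EuclideanSpace ℝ (Fin n) → ℝ} {x ξ p : EuclideanSpace ℝ (Fin n)} {c d : ℝ}
    (h : (ξ, scalarAddRankOne c d p) ∈ subjet Ω (fun y => -u y) x) :
    (-ξ, scalarAddRankOne (-c) (-d) p) ∈ superjet Ω u x := by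
  obtain ⟨r, hr, hle⟩ := h
  refine ⟨fun y => -r y, hr.neg_left, hle.mono fun y hy => ?_⟩
  simp only [jetPolynomial, toEuclideanLin_scalarAddRankOne, inner_add_left, inner_neg_left,
    real_inner_smul_left] at hy ⊢
  linarith

theorem mainTheorem10 (n : ℕ) (hn : 1 ≤ n) (a : Fin n → ℝ) (ha : ∀ i, 0 ≤ a i)
    (Ω : Set (EuclideanSpace ℝ (Fin n))) (hΩ : IsOpen Ω) (hΩc : IsConnected Ω) :
    (0 < a ⟨n - 1, Nat.sub_one_lt_of_lt hn⟩ →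
      ∀ u : EuclideanSpace ℝ (Fin n) → ℝ, ContinuousOn u Ω → (∀ x ∈ Ω, 0 ≤ u x) →
        IsViscositySupersolution (weightedPartialTrace a) (fun _ => 0) Ω u →
        ∀ x₀ ∈ Ω, IsMinOn u Ω x₀ → ∀ x ∈ Ω, u x = u x₀) ∧
    (0 < a ⟨0, hn⟩ →
      ∀ u : EuclideanSpace ℝ (Fin n) → ℝ, ContinuousOn u Ω →
        IsViscositySubsolution (weightedPartialTrace a) (fun _ => 0) Ω u →
        ∀ x₀ ∈ Ω, IsMaxOn u Ω x₀ → ∀ x ∈ Ω, u x = u x₀) := by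
  have hS : 0 ≤ ∑ i, a i := Finset.sum_nonneg fun i _ => ha i
  refine ⟨fun hpos u hu _ hsol x₀ hx₀ hmin => ?_, fun hpos u hu hsol x₀ hx₀ hmax x hx => ?_⟩
  · have hjet : ∀ x ∈ Ω, ∀ ξ p : EuclideanSpace ℝ (Fin n), ∀ c d : ℝ, p ≠ 0 → 0 ≤ d →
        (ξ, scalarAddRankOne c d p) ∈ subjet Ω u x →
          c * ∑ i, a i + d * ‖p‖ ^ 2 * a ⟨n - 1, Nat.sub_one_lt_of_lt hn⟩ ≤ 0 := by
      intro x hx ξ p c d hp hd h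
      have h1 : weightedPartialTrace a (scalarAddRankOne c d p) ≤ 0 :=
        hsol.2 x hx (ξ, scalarAddRankOne c d p) h
      exact (le_weightedPartialTrace_scalarAddRankOne hn ha c hd hp).trans h1
    exact eqOn_of_isMinOn_of_subjet hΩ hΩc hu hS hpos hjet hx₀ hmin
  · have hjet : ∀ x ∈ Ω, ∀ ξ p : EuclideanSpace ℝ (Fin n), ∀ c d : ℝ, p ≠ 0 → 0 ≤ d →
        (ξ, scalarAddRankOne c d p) ∈ subjet Ω (fun y => -u y) x →
          c * ∑ i, a i + d * ‖p‖ ^ 2 * a ⟨0, hn⟩ ≤ 0 := by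
      intro x hx ξ p c d hp hd h
      have h1 : 0 ≤ weightedPartialTrace a (scalarAddRankOne (-c) (-d) p) :=
        hsol.2 x hx (-ξ, scalarAddRankOne (-c) (-d) p) (neg_scalarAddRankOne_mem_superjet h)
      have h2 := weightedPartialTrace_scalarAddRankOne_le hn ha (-c) (neg_nonpos.2 hd) hp
      linarith
    exact neg_injective (eqOn_of_isMinOn_of_subjet hΩ hΩc hu.neg hS hpos hjet hx₀ hmax.neg x hx)
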